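/- Let $n\ge 0$ and $k\ge 0$ be integers, let $\|\cdot\|$ be a norm on $\mathbb{R}^n$ (for example a $p$-norm, $1\le p\le\infty$), and write $\|\cdot\|$ also for the induced operator norm on $\mathbb{R}^{n\times n}$. For a block matrix $\mathbf{A}=(A_0,\dots,A_k)$ with $A_i\in\mathbb{R}^{n\times n}$ and a block vector $\mathbf{q}=(q_0,\dots,q_k)$ with $q_i\in\mathbb{R}^n$, EVLCP$(\mathbf{A},\mathbf{q})$ is the problem of finding $x\in\mathbb{R}^n$ with $$\min\{A_0x+q_0,\,A_1x+q_1,\dots,A_kx+q_k\}=0,$$ where minima, maxima and inequalities of vectors are taken componentwise. Let $\mathbf{M}=(M_0,\dots,M_k)$ be a block matrix with the row $\mathcal{W}$-property, that is, $$\min(M_0x,\dots,M_kx)\le 0\le\max(M_0x,\dots,M_kx)\ \Longrightarrow\ x=0 .$$ Let $\mathcal{D}$ be the set of tuples $(D_0,\dots,D_k)$ of diagonal $n\times n$ matrices with diagonal entries in $[0,1]$ and $\sum_{i=0}^kD_i=I$, and for $i=0,\dots,k$ put $$\alpha_i(\mathbf{M})=\max_{(D_0,\dots,D_k)\in\mathcal{D}}\Big\|\Big(\sum_{j=0}^kD_jM_j\Big)^{-1}D_i\Big\|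 .$$ For a real number $\eta<1$ put $\tau_i(\mathbf{M})=\dfrac{\alpha_i(\mathbf{M})}{1-\eta}$ and $$\mathfrak{M}_\eta=\Big\{\mathbf{A}=(A_0,\dots,A_k)\ \Big|\ \sum_{i=0}^k\alpha_i(\mathbf{M})\|A_i-M_i\|\le\eta\Big\}.$$ **Theorem 3.2.** Let $\mathbf{A},\mathbf{B}\in\mathfrak{M}_\eta$, and let $\bar{\mathbf{q}}=(\bar q_0,\dots,\bar q_k)$ and $\bar{\mathbf{p}}=(\bar p_0,\dots,\bar p_k)$ be arbitrary block vectors with entries in $\mathbb{R}^n$. Then EVLCP$(\mathbf{A},\bar{\mathbf{q}})$ has a unique solution $x^*$, EVLCP$(\mathbf{B},\bar{\mathbf{p}})$ has a unique solution $y^*$, and $$\|x^*-y^*\|\le\Big(\sum_{i=0}^k\tau_i(\mathbf{M})\|A_i-B_i\|\Big)\Big(\sum_{i=0}^k\tau_i(\mathbf{M})\|\bar p_i\|\Big)+\sum_{i=0}^k\tau_i(\mathbf{M})\|\bar q_i-\bar p_i\| .$$ -/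

import Mathlib

open scoped Matrix

noncomputable section

namespace EVLCP

/-- A block matrix `(M₀, …, M_k)` of real `n × n` matrices. -/
abbrev BlockMatrix (n k : ℕ) : Type := Fin (k + 1) → Matrix (Fin n) (Fin n) ℝ

/-- A block vector `(q₀, …, q_k)` of vectors in `ℝⁿ`. -/
abbrev BlockVector (n k : ℕ) : Type := Fin (k + 1) → Fin n → ℝ

/-- The componentwise minimum `min {v₀, …, v_k}` of vectors in `ℝⁿ`. -/
def blockMin {n k : ℕ} (v : BlockVector n k) : Fin n → ℝ :=
  fun l => Finset.univ.inf' Finset.univ_nonempty fun i => v i l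

/-- The componentwise maximum `max {v₀, …, v_k}` of vectors in `ℝⁿ`. -/
def blockMax {n k : ℕ} (v : BlockVector n k) : Fin n → ℝ :=
  fun l => Finset.univ.sup' Finset.univ_nonempty fun i => v i l

/-- `x` solves the extended vertical linear complementarity problem EVLCP `(M, q)`:
`min {M₀ x + q₀, …, M_k x + q_k} = 0`. -/
def IsSolution {n k : ℕ} (M : BlockMatrix n k) (q : BlockVector n k) (x : Fin n → ℝ) : Prop :=
  blockMin (fun i => M i *ᵥ x + q i) = 0

/-- The row `W`-property of a block matrix:
`min (M₀ x, …, M_k x) ≤ 0 ≤ max (M₀ x, …, M_k x)` implies `x = 0`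
(the order on `ℝⁿ` is componentwise). -/
def RowWProperty {n k : ℕ} (M : BlockMatrix n k) : Prop :=
  ∀ x : Fin n → ℝ,
    blockMin (fun i => M i *ᵥ x) ≤ 0 → 0 ≤ blockMax (fun i => M i *ᵥ x) → x = 0

/-- The set of tuples `(D₀, …, D_k)` of diagonal matrices with diagonal entries in `[0, 1]`
and `D₀ + ⋯ + D_k = I`. -/
def diagTuples (n k : ℕ) : Set (BlockMatrix n k) :=
  {D | (∀ i, ∃ d : Fin n → ℝ, (∀ l, d l ∈ Set.Icc (0 : ℝ) 1) ∧ D i = Matrix.diagonal d) ∧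
    ∑ i, D i = 1}

/-- The matrix norm induced by a vector norm `N` on `ℝⁿ`: `‖A‖ = sup {N (A x) | N x ≤ 1}`. -/
def matNorm {n : ℕ} (N : Seminorm ℝ (Fin n → ℝ)) (A : Matrix (Fin n) (Fin n) ℝ) : ℝ :=
  sSup ((fun x => N (A *ᵥ x)) '' {x | N x ≤ 1})

/-- `α_i(M)`, the maximum over `(D₀, …, D_k)` of `‖S⁻¹ D_i‖`, where `S = ∑ j, D_j M_j`.
If `M` has the row `W`-property, then every `S` is nonsingular, so that a continuous function
is maximised over a nonempty compact set and the supremum is this maximum. -/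
def alpha {n k : ℕ} (N : Seminorm ℝ (Fin n → ℝ)) (M : BlockMatrix n k) (i : Fin (k + 1)) : ℝ :=
  sSup ((fun D : BlockMatrix n k => matNorm N ((∑ j, D j * M j)⁻¹ * D i)) '' diagTuples n k)

/-- `τ_i(M) = α_i(M) / (1 - η)`. -/
def tau {n k : ℕ} (N : Seminorm ℝ (Fin n → ℝ)) (M : BlockMatrix n k) (η : ℝ)
    (i : Fin (k + 1)) : ℝ :=
  1 / (1 - η) * alpha N M i

/-- The set of block matrices `A` with `∑ i, α_i(M) ‖A_i - M_i‖ ≤ η < 1`. -/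
def perturbationSet {n k : ℕ} (N : Seminorm ℝ (Fin n → ℝ)) (M : BlockMatrix n k) (η : ℝ) :
    Set (BlockMatrix n k) :=
  {A | ∑ i, alpha N M i * matNorm N (A i - M i) ≤ η ∧ η < 1}

end EVLCP

end

/-! In each row, a difference of two minima is a convex combination of the termwise differences
(`exists_blockMin_sub_blockMin`). Hence solutions x of (A, q) and y of (B, p) satisfy, for some
diagonal weights D_i summing to I, (∑ D_i A_i)(x - y) = -∑ D_i ((A_i - B_i) y + q_i - p_i).

For M itself, S = ∑ D_i M_i is nonsingular, and S z = ∑ D_i v_i gives N z ≤ ∑ α_i N(v_i). Replacing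
M by A moves (M_i - A_i) z to the right-hand side, where it costs at most η N z; absorbing this
turns α_i into τ_i (`le_sum_tau_mul`). With v = 0 this shows that A inherits the row W-property;
with the identity above it bounds N(x - y) in terms of N y. Comparing y with the solution 0 of (B,
0) bounds N y.

Existence is by continuation from the linear map M_0 to the piecewise linear map of the problem: the
weighted combinations expand distances by a uniform factor. -/

namespace EVLCP

/-! ### Method of continuity for Lipschitz maps -/

/-- If `f` expands distances by at least `c` and is onto, then a perturbation of `f` by a map with
Lipschitz constant less than `c` is onto. -/
theorem surjective_add_of_expanding {E : Type*} [NormedAddCommGroup E] [CompleteSpace E]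
    {f g : E → E} {c L : ℝ} (hc : 0 < c) (hL : 0 ≤ L) (hLc : L < c)
    (hf : ∀ x y, c * ‖x - y‖ ≤ ‖f x - f y‖) (hs : Function.Surjective f)
    (hg : ∀ x y, ‖g x - g y‖ ≤ L * ‖x - y‖) : Function.Surjective fun x => f x + g x := by
  intro y
  obtain ⟨r, hr⟩ := hs.hasRightInverse
  -- The right inverse `r` of `f` is Lipschitz with constant 1 / c, and a fixed point of this map
  -- solves f x = y - g x.
  have hK : ContractingWith (Real.toNNReal (L / c)) fun x => r (y - g x) := by
    refine ⟨?_, LipschitzWith.of_dist_le_mul fun u v => ?_⟩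
    · rw [Real.toNNReal_lt_one, div_lt_one hc]
      exact hLc
    · rw [dist_eq_norm, dist_eq_norm, Real.coe_toNNReal _ (by positivity), div_mul_eq_mul_div,
        le_div_iff₀ hc, mul_comm]
      refine (hf _ _).trans ?_
      rw [hr, hr, sub_sub_sub_cancel_left, norm_sub_rev]
      exact hg u v
  refine ⟨hK.fixedPoint _, ?_⟩
  have h := congrArg f hK.fixedPoint_isFixedPt
  rw [hr] at h
  simp only
  rw [← h]
  abel

/-- The method of continuity for Lipschitz maps: along the segment from `f` to `g`, surjectivity
propagates if all maps expand distances by a common factor. -/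
theorem surjective_of_homotopy {E : Type*} [NormedAddCommGroup E] [NormedSpace ℝ E]
    [CompleteSpace E] {f g : E → E} {c L : ℝ} (hc : 0 < c)
    (hL : ∀ x y, ‖(g x - f x) - (g y - f y)‖ ≤ L * ‖x - y‖)
    (hexp : ∀ t ∈ Set.Icc (0 : ℝ) 1, ∀ x y,
      c * ‖x - y‖ ≤ ‖(f x + t • (g x - f x)) - (f y + t • (g y - f y))‖)
    (hf : Function.Surjective f) : Function.Surjective g := by
  -- With `m` equal steps, each one perturbs by a map with Lipschitz constant |L| / m < c. The
  -- absolute value is there because `L` may be negative.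
  obtain ⟨m, hm⟩ := exists_nat_gt (|L| / c)
  have hm0 : (0 : ℝ) < m := lt_of_le_of_lt (by positivity) hm
  have key : ∀ j : ℕ, j ≤ m →
      Function.Surjective fun x => f x + ((j : ℝ) / m) • (g x - f x) := by
    intro j
    induction j with
    | zero => simpa using hf
    | succ j ih =>
      intro hj
      have ht : (j : ℝ) / m ∈ Set.Icc (0 : ℝ) 1 := by
        refine ⟨by positivity, ?_⟩
        rw [div_le_one hm0]
        exact_mod_cast (Nat.le_succ j).trans hj
      have h := surjective_add_of_expanding (g := fun x => (1 / (m : ℝ)) • (g x - f x))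
        (L := |L| / m) hc (by positivity)
        (by rwa [div_lt_iff₀ hm0, mul_comm, ← div_lt_iff₀ hc]) (hexp _ ht)
        (ih (Nat.le_of_succ_le hj)) (fun x y => by
          rw [← smul_sub, norm_smul, Real.norm_of_nonneg (by positivity)]
          calc 1 / (m : ℝ) * ‖(g x - f x) - (g y - f y)‖
              ≤ 1 / (m : ℝ) * (|L| * ‖x - y‖) := by
                gcongr
                exact (hL x y).trans (by gcongr; exact le_abs_self L)
            _ = _ := by ring)
      have e : (fun x => f x + (((j + 1 : ℕ) : ℝ) / m) • (g x - f x)) =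
          fun x => f x + ((j : ℝ) / m) • (g x - f x) + (1 / (m : ℝ)) • (g x - f x) := by
        funext x
        rw [add_assoc, ← add_smul]
        congr 2
        push_cast
        ring
      rw [e]
      exact h
  have h := key m le_rfl
  rw [div_self hm0.ne'] at h
  simpa using h

/-! ### Row-wise convex combinations -/

/-- A number between two entries of a family is a convex combination of the family. -/
theorem exists_mem_stdSimplex_sum_mul_eq {ι : Type*} [Fintype ι] [DecidableEq ι] {u : ι → ℝ}
    {v : ℝ} {i j : ι} (hi : u i ≤ v) (hj : v ≤ u j) :
    ∃ w ∈ stdSimplex ℝ ι, ∑ l, w l * u l = v := by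
  have hv : v ∈ segment ℝ (u i) (u j) := by
    rw [segment_eq_Icc (hi.trans hj)]
    exact ⟨hi, hj⟩
  obtain ⟨a, b, ha, hb, hab, rfl⟩ := hv
  refine ⟨a • Pi.single i 1 + b • Pi.single j 1, convex_stdSimplex ℝ ι
    (single_mem_stdSimplex ℝ i) (single_mem_stdSimplex ℝ j) ha hb hab, ?_⟩
  simp [add_mul, Finset.sum_add_distrib, Pi.single_apply]

/-- A difference of minima is a convex combination of the differences. -/
theorem exists_mem_stdSimplex_inf'_sub_inf' {k : ℕ} (a b : Fin (k + 1) → ℝ) :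
    ∃ w ∈ stdSimplex ℝ (Fin (k + 1)), ∑ i, w i * (a i - b i) =
      Finset.univ.inf' Finset.univ_nonempty a - Finset.univ.inf' Finset.univ_nonempty b := by
  obtain ⟨i, -, hi⟩ := Finset.exists_mem_eq_inf' Finset.univ_nonempty a
  obtain ⟨j, -, hj⟩ := Finset.exists_mem_eq_inf' Finset.univ_nonempty b
  have hb := Finset.inf'_le b (Finset.mem_univ i)
  have ha := Finset.inf'_le a (Finset.mem_univ j)
  exact exists_mem_stdSimplex_sum_mul_eq (u := fun l => a l - b l) (i := i) (j := j)
    (by linarith) (by linarith)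

/-- Row weights: for each row, the coefficients of a convex combination of the blocks. -/
def rowWeights (n k : ℕ) : Set (Fin n → Fin (k + 1) → ℝ) :=
  Set.univ.pi fun _ => stdSimplex ℝ (Fin (k + 1))

theorem rowWeights_nonneg {n k : ℕ} {d : Fin n → Fin (k + 1) → ℝ} (hd : d ∈ rowWeights n k)
    (l : Fin n) (i : Fin (k + 1)) : 0 ≤ d l i :=
  (hd l trivial).1 i

theorem rowWeights_sum {n k : ℕ} {d : Fin n → Fin (k + 1) → ℝ} (hd : d ∈ rowWeights n k)
    (l : Fin n) : ∑ i, d l i = 1 :=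
  (hd l trivial).2

theorem isCompact_rowWeights (n k : ℕ) : IsCompact (rowWeights n k) :=
  isCompact_univ_pi fun _ => isCompact_stdSimplex ℝ _

/-- The row-wise convex combination of the vectors of a block vector. -/
def rowComb {n k : ℕ} (d : Fin n → Fin (k + 1) → ℝ) (v : BlockVector n k) : Fin n → ℝ :=
  fun l => ∑ i, d l i * v i l

theorem rowComb_add {n k : ℕ} (d : Fin n → Fin (k + 1) → ℝ) (v w : BlockVector n k) :
    rowComb d (fun i => v i + w i) = rowComb d v + rowComb d w := by
  funext l
  simp [rowComb, mul_add, Finset.sum_add_distrib]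

theorem rowComb_eq_sum {n k : ℕ} (d : Fin n → Fin (k + 1) → ℝ) (v : BlockVector n k) :
    rowComb d v = ∑ i, Matrix.diagonal (fun l => d l i) *ᵥ v i := by
  funext l
  simp [rowComb, Matrix.mulVec_diagonal, Finset.sum_apply]

theorem sum_diagonal_mul_mulVec {n k : ℕ} (d : Fin n → Fin (k + 1) → ℝ) (M : BlockMatrix n k)
    (x : Fin n → ℝ) :
    (∑ i, Matrix.diagonal (fun l => d l i) * M i) *ᵥ x = rowComb d fun i => M i *ᵥ x := by
  rw [rowComb_eq_sum, Matrix.sum_mulVec]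
  simp [Matrix.mulVec_mulVec]

theorem norm_rowComb_le {n k : ℕ} {d : Fin n → Fin (k + 1) → ℝ} (hd : d ∈ rowWeights n k)
    {v : BlockVector n k} {C : ℝ} (hC : 0 ≤ C) (hv : ∀ i, ‖v i‖ ≤ C) : ‖rowComb d v‖ ≤ C := by
  refine (pi_norm_le_iff_of_nonneg hC).2 fun l => ?_
  calc ‖∑ i, d l i * v i l‖ ≤ ∑ i, ‖d l i * v i l‖ := norm_sum_le _ _
    _ ≤ ∑ i, d l i * C := Finset.sum_le_sum fun i _ => by
        rw [norm_mul, Real.norm_of_nonneg (rowWeights_nonneg hd l i)]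
        exact mul_le_mul_of_nonneg_left ((norm_le_pi_norm _ l).trans (hv i))
          (rowWeights_nonneg hd l i)
    _ = C := by rw [← Finset.sum_mul, rowWeights_sum hd, one_mul]

theorem exists_blockMin_sub_blockMin {n k : ℕ} (v w : BlockVector n k) :
    ∃ d ∈ rowWeights n k, blockMin v - blockMin w = rowComb d fun i => v i - w i := by
  choose d hd hdv using fun l : Fin n =>
    exists_mem_stdSimplex_inf'_sub_inf' (fun i => v i l) (fun i => w i l)
  exact ⟨d, fun l _ => hd l, funext fun l => (hdv l).symm⟩

/-! ### Row weights, diagonal tuples and the row W-property -/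

theorem diagonal_mem_diagTuples {n k : ℕ} {d : Fin n → Fin (k + 1) → ℝ}
    (hd : d ∈ rowWeights n k) :
    (fun i => Matrix.diagonal fun l => d l i) ∈ diagTuples n k := by
  refine ⟨fun i => ⟨_, fun l => ⟨rowWeights_nonneg hd l i, ?_⟩, rfl⟩, ?_⟩
  · rw [← rowWeights_sum hd l]
    exact Finset.single_le_sum (fun j _ => rowWeights_nonneg hd l j) (Finset.mem_univ i)
  · ext a b
    rw [Matrix.sum_apply]
    by_cases h : a = b
    · subst h
      simp [rowWeights_sum hd]
    · simp [h]

theorem exists_rowWeights_of_mem_diagTuples {n k : ℕ} {D : BlockMatrix n k}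
    (hD : D ∈ diagTuples n k) :
    ∃ d ∈ rowWeights n k, D = fun i => Matrix.diagonal fun l => d l i := by
  obtain ⟨h1, h2⟩ := hD
  choose d hd hdD using h1
  refine ⟨fun l i => d i l, fun l _ => ⟨fun i => (hd i l).1, ?_⟩, funext hdD⟩
  have h := congrFun (congrFun h2 l) l
  rw [Matrix.sum_apply] at h
  simpa [hdD] using h

/-- A weighted mean lies between the minimum and the maximum, so a vanishing mean in every row gives
the hypotheses of the row W-property. -/
theorem RowWProperty.eq_zero_of_rowComb_eq_zero {n k : ℕ} {M : BlockMatrix n k}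
    (hM : RowWProperty M) {d : Fin n → Fin (k + 1) → ℝ} (hd : d ∈ rowWeights n k)
    {x : Fin n → ℝ} (hx : rowComb d (fun i => M i *ᵥ x) = 0) : x = 0 := by
  refine hM x (fun l => ?_) (fun l => ?_)
  · by_contra hlt
    have hpos : 0 < Finset.univ.inf' Finset.univ_nonempty fun i => (M i *ᵥ x) l := not_le.1 hlt
    have h0 : ∑ i, d l i * (M i *ᵥ x) l = 0 := congrFun hx l
    have h1 : ∑ i, d l i * (Finset.univ.inf' Finset.univ_nonempty fun i => (M i *ᵥ x) l) ≤
        ∑ i, d l i * (M i *ᵥ x) l := Finset.sum_le_sum fun i _ =>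
      mul_le_mul_of_nonneg_left (Finset.inf'_le _ (Finset.mem_univ i)) (rowWeights_nonneg hd l i)
    rw [← Finset.sum_mul, rowWeights_sum hd] at h1
    linarith
  · by_contra hlt
    have hneg : (Finset.univ.sup' Finset.univ_nonempty fun i => (M i *ᵥ x) l) < 0 := not_le.1 hlt
    have h0 : ∑ i, d l i * (M i *ᵥ x) l = 0 := congrFun hx l
    have h1 : ∑ i, d l i * (M i *ᵥ x) l ≤
        ∑ i, d l i * (Finset.univ.sup' Finset.univ_nonempty fun i => (M i *ᵥ x) l) :=
      Finset.sum_le_sum fun i _ =>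
        mul_le_mul_of_nonneg_left (Finset.le_sup' (fun i => (M i *ᵥ x) l) (Finset.mem_univ i))
          (rowWeights_nonneg hd l i)
    rw [← Finset.sum_mul, rowWeights_sum hd] at h1
    linarith

/-- Converse of the previous lemma: in each row 0 lies between two entries, hence is a convex
combination of the entries. -/
theorem rowWProperty_of_rowComb {n k : ℕ} {M : BlockMatrix n k}
    (h : ∀ d ∈ rowWeights n k, ∀ x, rowComb d (fun i => M i *ᵥ x) = 0 → x = 0) :
    RowWProperty M := by
  intro x h1 h2
  have : ∀ l, ∃ w ∈ stdSimplex ℝ (Fin (k + 1)), ∑ i, w i * (M i *ᵥ x) l = 0 := by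
    intro l
    obtain ⟨i, -, hi⟩ := Finset.exists_mem_eq_inf' Finset.univ_nonempty fun i => (M i *ᵥ x) l
    obtain ⟨j, -, hj⟩ := Finset.exists_mem_eq_sup' Finset.univ_nonempty fun i => (M i *ᵥ x) l
    exact exists_mem_stdSimplex_sum_mul_eq (u := fun i => (M i *ᵥ x) l) (i := i) (j := j)
      (hi.symm.trans_le (h1 l)) ((h2 l).trans_eq hj)
  choose d hd hdx using this
  exact h d (fun l _ => hd l) x (funext hdx)

/-- Compactness of weights times the unit sphere makes nonsingularity uniform in the weights;
homogeneity extends the bound to all x. -/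
theorem RowWProperty.exists_pos_le_norm_rowComb {n k : ℕ} {M : BlockMatrix n k}
    (hM : RowWProperty M) : ∃ c > 0, ∀ d ∈ rowWeights n k, ∀ x : Fin n → ℝ,
      c * ‖x‖ ≤ ‖rowComb d fun i => M i *ᵥ x‖ := by
  have hcont : Continuous fun z : (Fin n → Fin (k + 1) → ℝ) × (Fin n → ℝ) =>
      ‖rowComb z.1 fun i => M i *ᵥ z.2‖ := by
    unfold rowComb Matrix.mulVec dotProduct
    fun_prop
  obtain ⟨c, hc, hle⟩ := ((isCompact_rowWeights n k).prod
    (isCompact_sphere (0 : Fin n → ℝ) 1)).exists_forall_le' hcont.continuousOn (a := 0) (by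
      rintro ⟨d, x⟩ ⟨hd, hx⟩
      refine norm_pos_iff.2 fun h => ?_
      have := hM.eq_zero_of_rowComb_eq_zero hd h
      simp_all)
  refine ⟨c, hc, fun d hd x => ?_⟩
  by_cases hx : x = 0
  · simp [hx]
  have hx' : ‖x‖ ≠ 0 := norm_ne_zero_iff.2 hx
  have h := hle (d, ‖x‖⁻¹ • x) ⟨hd, by simp [norm_smul, hx']⟩
  have e : (rowComb d fun i => M i *ᵥ (‖x‖⁻¹ • x)) = ‖x‖⁻¹ • rowComb d fun i => M i *ᵥ x := by
    rw [← sum_diagonal_mul_mulVec, ← sum_diagonal_mul_mulVec, Matrix.mulVec_smul]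
  simp only [e, norm_smul, norm_inv, norm_norm] at h
  rwa [inv_mul_eq_div, le_div_iff₀ (by positivity)] at h

/-! ### Existence of solutions -/

/-- A block matrix with the row `W`-property has a solution of every EVLCP. -/
theorem RowWProperty.exists_isSolution {n k : ℕ} {M : BlockMatrix n k} (hM : RowWProperty M)
    (q : BlockVector n k) : ∃ x, IsSolution M q x := by
  obtain ⟨c, hc, hle⟩ := hM.exists_pos_le_norm_rowComb
  obtain ⟨C, hC0, hC⟩ : ∃ C, 0 ≤ C ∧ ∀ i, ∀ x : Fin n → ℝ, ‖M i *ᵥ x‖ ≤ C * ‖x‖ := by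
    refine ⟨∑ i, ‖LinearMap.toContinuousLinearMap (Matrix.mulVecLin (M i))‖,
      Finset.sum_nonneg fun i _ => norm_nonneg _, fun i x => ?_⟩
    refine ((LinearMap.toContinuousLinearMap (Matrix.mulVecLin (M i))).le_opNorm x).trans ?_
    gcongr
    exact Finset.single_le_sum
      (f := fun i => ‖LinearMap.toContinuousLinearMap (Matrix.mulVecLin (M i))‖)
      (fun j _ => norm_nonneg _) (Finset.mem_univ i)
  let g : (Fin n → ℝ) → Fin n → ℝ := fun x => blockMin fun i => M i *ᵥ x + q i
  have hg : ∀ x y, ∃ d ∈ rowWeights n k,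
      g x - g y = rowComb d fun i => M i *ᵥ (x - y) := by
    intro x y
    obtain ⟨d, hd, h⟩ := exists_blockMin_sub_blockMin (fun i => M i *ᵥ x + q i)
      fun i => M i *ᵥ y + q i
    refine ⟨d, hd, h.trans ?_⟩
    simp [Matrix.mulVec_sub]
  -- All weight on block 0: the homotopy starts at the linear bijection x ↦ M_0 x.
  let e : Fin n → Fin (k + 1) → ℝ := fun _ => Pi.single 0 1
  have he : e ∈ rowWeights n k := fun l _ => single_mem_stdSimplex ℝ 0
  have heM : ∀ x, rowComb e (fun i => M i *ᵥ x) = M 0 *ᵥ x := by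
    intro x
    funext l
    simp [rowComb, e, Pi.single_apply]
  have hsurj : Function.Surjective fun x => M 0 *ᵥ x := by
    have hinj : Function.Injective (Matrix.mulVecLin (M 0)) := by
      refine (injective_iff_map_eq_zero _).2 fun x hx => ?_
      exact hM.eq_zero_of_rowComb_eq_zero he ((heM x).trans hx)
    exact LinearMap.surjective_of_injective hinj
  refine surjective_of_homotopy (g := g) (L := C + C) hc (fun x y => ?_)
    (fun t ht x y => ?_) hsurj 0
  · obtain ⟨d, hd, h⟩ := hg x y
    rw [sub_sub_sub_comm, h, ← Matrix.mulVec_sub, add_mul]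
    exact (norm_sub_le _ _).trans
      (add_le_add (norm_rowComb_le hd (by positivity) fun i => hC i _) (hC 0 _))
  · obtain ⟨d, hd, h⟩ := hg x y
    -- Along the segment, increments are again row combinations of the M_i (x - y), with weights (1
    -- - t) e + t d, so the uniform constant `c` applies.
    have hmem : (1 - t) • e + t • d ∈ rowWeights n k :=
      convex_pi (fun _ _ => convex_stdSimplex ℝ _) he hd (sub_nonneg.2 ht.2) ht.1 (by ring)
    refine (hle _ hmem (x - y)).trans_eq (congrArg _ ?_)
    have h1 : (rowComb ((1 - t) • e + t • d) fun i => M i *ᵥ (x - y)) =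
        (1 - t) • rowComb e (fun i => M i *ᵥ (x - y)) +
          t • rowComb d fun i => M i *ᵥ (x - y) := by
      funext l
      simp [rowComb, add_mul, Finset.sum_add_distrib, Finset.mul_sum, mul_assoc]
    rw [h1, heM, ← h, Matrix.mulVec_sub]
    module

/-! ### The norm `N` and its induced matrix norm -/

theorem continuous_seminorm {n : ℕ} (N : Seminorm ℝ (Fin n → ℝ)) : Continuous N :=
  N.convexOn.locallyLipschitz.continuous

theorem exists_seminorm_le_norm {n : ℕ} (N : Seminorm ℝ (Fin n → ℝ)) :
    ∃ C > 0, ∀ x, N x ≤ C * ‖x‖ :=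
  N.bound_of_continuous_normedSpace (continuous_seminorm N)

theorem exists_norm_le_seminorm {n : ℕ} {N : Seminorm ℝ (Fin n → ℝ)}
    (hN : ∀ x, N x = 0 → x = 0) : ∃ c > 0, ∀ x, c * ‖x‖ ≤ N x := by
  obtain ⟨c, hc, hle⟩ := (isCompact_sphere (0 : Fin n → ℝ) 1).exists_forall_le'
    (continuous_seminorm N).continuousOn (a := 0) (fun x hx => by
      refine lt_of_le_of_ne (apply_nonneg N x) fun h => ?_
      have hx0 := hN x h.symm
      subst hx0
      simp at hx)
  refine ⟨c, hc, fun x => ?_⟩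
  by_cases hx : x = 0
  · simp [hx]
  have hx' : ‖x‖ ≠ 0 := norm_ne_zero_iff.2 hx
  have h := hle (‖x‖⁻¹ • x) (by simp [norm_smul, hx'])
  rw [map_smul_eq_mul, norm_inv, norm_norm] at h
  rwa [inv_mul_eq_div, le_div_iff₀ (by positivity)] at h

theorem matNorm_nonneg {n : ℕ} (N : Seminorm ℝ (Fin n → ℝ)) (A : Matrix (Fin n) (Fin n) ℝ) :
    0 ≤ matNorm N A := by
  refine Real.sSup_nonneg ?_
  rintro _ ⟨x, -, rfl⟩
  exact apply_nonneg N _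

theorem matNorm_neg {n : ℕ} (N : Seminorm ℝ (Fin n → ℝ)) (A : Matrix (Fin n) (Fin n) ℝ) :
    matNorm N (-A) = matNorm N A := by
  simp [matNorm, Matrix.neg_mulVec]

theorem matNorm_le {n : ℕ} {N : Seminorm ℝ (Fin n → ℝ)} {A : Matrix (Fin n) (Fin n) ℝ} {C : ℝ}
    (hC : 0 ≤ C) (h : ∀ x, N (A *ᵥ x) ≤ C * N x) : matNorm N A ≤ C := by
  refine Real.sSup_le ?_ hC
  rintro _ ⟨x, hx, rfl⟩
  exact (h x).trans (mul_le_of_le_one_right hC hx)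

theorem le_matNorm_mul {n : ℕ} {N : Seminorm ℝ (Fin n → ℝ)} (hN : ∀ x, N x = 0 → x = 0)
    (A : Matrix (Fin n) (Fin n) ℝ) (x : Fin n → ℝ) : N (A *ᵥ x) ≤ matNorm N A * N x := by
  obtain ⟨C, hC, hNC⟩ := exists_seminorm_le_norm N
  obtain ⟨c, hc, hcN⟩ := exists_norm_le_seminorm hN
  let T := LinearMap.toContinuousLinearMap (Matrix.mulVecLin A)
  -- A real `sSup` bounds its elements only if the set is bounded; definiteness of `N` provides
  -- this.
  have hbdd : BddAbove ((fun x => N (A *ᵥ x)) '' {x | N x ≤ 1}) := by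
    refine ⟨C * (‖T‖ * c⁻¹), ?_⟩
    rintro _ ⟨y, hy, rfl⟩
    have hy' : ‖y‖ ≤ c⁻¹ := by
      rw [← one_div, le_div_iff₀ hc, mul_comm]
      exact (hcN y).trans hy
    calc N (A *ᵥ y) ≤ C * ‖A *ᵥ y‖ := hNC _
      _ ≤ C * (‖T‖ * ‖y‖) := by
        gcongr
        exact T.le_opNorm y
      _ ≤ _ := by gcongr
  by_cases hx : N x = 0
  · simp [hN x hx]
  have hpos : 0 < N x := lt_of_le_of_ne (apply_nonneg N x) (Ne.symm hx)
  have h : N (A *ᵥ ((N x)⁻¹ • x)) ≤ matNorm N A := by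
    refine le_csSup hbdd ⟨(N x)⁻¹ • x, ?_, rfl⟩
    simp [map_smul_eq_mul, abs_of_pos hpos, hpos.ne']
  rw [Matrix.mulVec_smul, map_smul_eq_mul, Real.norm_of_nonneg (by positivity)] at h
  rwa [inv_mul_eq_div, div_le_iff₀ hpos] at h

theorem alpha_nonneg {n k : ℕ} (N : Seminorm ℝ (Fin n → ℝ)) (M : BlockMatrix n k)
    (i : Fin (k + 1)) : 0 ≤ alpha N M i := by
  refine Real.sSup_nonneg ?_
  rintro _ ⟨D, -, rfl⟩
  exact matNorm_nonneg N _

/-! ### The constants α_i -/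

theorem RowWProperty.isUnit_det {n k : ℕ} {M : BlockMatrix n k} (hM : RowWProperty M)
    {d : Fin n → Fin (k + 1) → ℝ} (hd : d ∈ rowWeights n k) :
    IsUnit (∑ i, Matrix.diagonal (fun l => d l i) * M i).det := by
  rw [← Matrix.isUnit_iff_isUnit_det, ← Matrix.mulVec_injective_iff_isUnit]
  refine (injective_iff_map_eq_zero (Matrix.mulVecLin _)).2 fun x hx => ?_
  exact hM.eq_zero_of_rowComb_eq_zero hd ((sum_diagonal_mul_mulVec d M x).symm.trans hx)

/-- The content is that the supremum defining `alpha` is over a bounded set, which follows from the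
uniform lower bound for the row combinations. -/
theorem RowWProperty.matNorm_le_alpha {n k : ℕ} {N : Seminorm ℝ (Fin n → ℝ)}
    (hN : ∀ x, N x = 0 → x = 0) {M : BlockMatrix n k} (hM : RowWProperty M)
    {d : Fin n → Fin (k + 1) → ℝ} (hd : d ∈ rowWeights n k) (i : Fin (k + 1)) :
    matNorm N ((∑ j, Matrix.diagonal (fun l => d l j) * M j)⁻¹ *
      Matrix.diagonal fun l => d l i) ≤ alpha N M i := by
  obtain ⟨C, hC, hNC⟩ := exists_seminorm_le_norm N
  obtain ⟨c, hc, hcN⟩ := exists_norm_le_seminorm hN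
  obtain ⟨b, hb, hbM⟩ := hM.exists_pos_le_norm_rowComb
  refine le_csSup ⟨C * (b⁻¹ * c⁻¹), ?_⟩ ⟨_, diagonal_mem_diagTuples hd, rfl⟩
  rintro _ ⟨D, hD, rfl⟩
  obtain ⟨a, ha, rfl⟩ := exists_rowWeights_of_mem_diagTuples hD
  refine matNorm_le (by positivity) fun x => ?_
  set S := ∑ j, Matrix.diagonal (fun l => a l j) * M j with hS
  set z := (S⁻¹ * Matrix.diagonal fun l => a l i) *ᵥ x with hz
  -- S z = D_i x, with the right-hand side written as the row combination of the block vector whose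
  -- only nonzero block is x in place i.
  have h1 : (rowComb a fun j => M j *ᵥ z) = rowComb a (Pi.single i x) := by
    rw [← sum_diagonal_mul_mulVec, ← hS, hz, Matrix.mulVec_mulVec, ← mul_assoc,
      Matrix.mul_nonsing_inv _ (hM.isUnit_det ha), one_mul]
    funext l
    rw [Matrix.mulVec_diagonal, rowComb, Finset.sum_eq_single i] <;> simp +contextual
  have h2 : b * ‖z‖ ≤ ‖x‖ := by
    refine (hbM a ha z).trans ?_
    rw [h1]
    refine norm_rowComb_le ha (norm_nonneg x) fun j => ?_
    by_cases hj : j = i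
    · subst hj; simp
    · simp [hj]
  calc N z ≤ C * ‖z‖ := hNC z
    _ ≤ C * (b⁻¹ * (c⁻¹ * N x)) := by
      gcongr
      rw [inv_mul_eq_div, inv_mul_eq_div, le_div_iff₀ hb, le_div_iff₀ hc]
      calc ‖z‖ * b * c = c * (b * ‖z‖) := by ring
        _ ≤ c * ‖x‖ := by gcongr
        _ ≤ N x := hcN x
    _ = _ := by ring

/-- Solving the weighted system gives z = ∑ S⁻¹ D_i v_i, and α_i bounds the norm of S⁻¹ D_i whatever
the weights. -/
theorem RowWProperty.le_sum_alpha_mul {n k : ℕ} {N : Seminorm ℝ (Fin n → ℝ)}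
    (hN : ∀ x, N x = 0 → x = 0) {M : BlockMatrix n k} (hM : RowWProperty M)
    {d : Fin n → Fin (k + 1) → ℝ} (hd : d ∈ rowWeights n k) {z : Fin n → ℝ}
    {v : BlockVector n k} (h : (rowComb d fun i => M i *ᵥ z) = rowComb d v) :
    N z ≤ ∑ i, alpha N M i * N (v i) := by
  set S := ∑ j, Matrix.diagonal (fun l => d l j) * M j with hS
  have hz : z = ∑ i, (S⁻¹ * Matrix.diagonal fun l => d l i) *ᵥ v i := by
    have h1 : S *ᵥ z = ∑ i, Matrix.diagonal (fun l => d l i) *ᵥ v i := by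
      rw [hS, sum_diagonal_mul_mulVec, h, rowComb_eq_sum]
    calc z = S⁻¹ *ᵥ (S *ᵥ z) := by
          rw [Matrix.mulVec_mulVec, Matrix.nonsing_inv_mul _ (hM.isUnit_det hd),
            Matrix.one_mulVec]
      _ = _ := by
          rw [h1, Matrix.mulVec_sum]
          simp only [Matrix.mulVec_mulVec]
  calc N z = N (∑ i, (S⁻¹ * Matrix.diagonal fun l => d l i) *ᵥ v i) := congrArg N hz
    _ ≤ ∑ i, N ((S⁻¹ * Matrix.diagonal fun l => d l i) *ᵥ v i) :=
      Finset.le_sum_of_subadditive N (map_zero N).le (map_add_le_add N) _ _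
    _ ≤ _ := Finset.sum_le_sum fun i _ => (le_matNorm_mul hN _ _).trans
      (mul_le_mul_of_nonneg_right (hM.matNorm_le_alpha hN hd i) (apply_nonneg N _))

/-! ### Perturbed block matrices and comparison of solutions -/

/-- The perturbation bound: row-wise combinations of a perturbed block matrix are invertible,
with `α_i` replaced by `τ_i`. -/
theorem RowWProperty.le_sum_tau_mul {n k : ℕ} {N : Seminorm ℝ (Fin n → ℝ)}
    (hN : ∀ x, N x = 0 → x = 0) {M : BlockMatrix n k} (hM : RowWProperty M) {η : ℝ}
    {A : BlockMatrix n k} (hA : A ∈ perturbationSet N M η)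
    {d : Fin n → Fin (k + 1) → ℝ} (hd : d ∈ rowWeights n k) {z : Fin n → ℝ}
    {v : BlockVector n k} (h : (rowComb d fun i => A i *ᵥ z) = rowComb d v) :
    N z ≤ ∑ i, tau N M η i * N (v i) := by
  obtain ⟨hsum, hη⟩ := hA
  have h1 : (rowComb d fun i => M i *ᵥ z) = rowComb d fun i => (M i - A i) *ᵥ z + v i := by
    rw [rowComb_add, ← h, ← rowComb_add]
    simp [Matrix.sub_mulVec]
  have h2 : N z ≤ η * N z + ∑ i, alpha N M i * N (v i) := by
    refine (hM.le_sum_alpha_mul hN hd h1).trans ?_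
    calc ∑ i, alpha N M i * N ((M i - A i) *ᵥ z + v i)
        ≤ ∑ i, (alpha N M i * matNorm N (A i - M i) * N z + alpha N M i * N (v i)) := by
          refine Finset.sum_le_sum fun i _ => ?_
          rw [mul_assoc, ← mul_add]
          refine mul_le_mul_of_nonneg_left ((map_add_le_add N _ _).trans ?_) (alpha_nonneg N M i)
          rw [← neg_sub (M i), matNorm_neg]
          exact add_le_add_left (le_matNorm_mul hN _ _) _
      _ ≤ _ := by
          rw [Finset.sum_add_distrib, ← Finset.sum_mul]
          gcongr
  have h3 : ∑ i, tau N M η i * N (v i) = (∑ i, alpha N M i * N (v i)) / (1 - η) := by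
    rw [Finset.sum_div]
    exact Finset.sum_congr rfl fun i _ => by rw [tau]; ring
  rw [h3, le_div_iff₀ (by linarith)]
  linarith

theorem RowWProperty.of_mem_perturbationSet {n k : ℕ} {N : Seminorm ℝ (Fin n → ℝ)}
    (hN : ∀ x, N x = 0 → x = 0) {M : BlockMatrix n k} (hM : RowWProperty M) {η : ℝ}
    {A : BlockMatrix n k} (hA : A ∈ perturbationSet N M η) : RowWProperty A := by
  refine rowWProperty_of_rowComb fun d hd x hx => hN x ?_
  have h := hM.le_sum_tau_mul hN hA hd (z := x) (v := 0) (by rw [hx]; simp [rowComb_eq_sum])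
  simp only [Pi.zero_apply, map_zero, mul_zero, Finset.sum_const_zero] at h
  exact le_antisymm h (apply_nonneg N x)

/-- A block matrix with the row `W`-property has exactly one solution of every EVLCP. -/
theorem RowWProperty.existsUnique_isSolution {n k : ℕ} {M : BlockMatrix n k}
    (hM : RowWProperty M) (q : BlockVector n k) : ∃! x, IsSolution M q x := by
  obtain ⟨x, hx⟩ := hM.exists_isSolution q
  refine ⟨x, hx, fun y hy => ?_⟩
  obtain ⟨d, hd, h⟩ := exists_blockMin_sub_blockMin (fun i => M i *ᵥ y + q i)
    fun i => M i *ᵥ x + q i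
  rw [show blockMin (fun i => M i *ᵥ y + q i) = 0 from hy,
    show blockMin (fun i => M i *ᵥ x + q i) = 0 from hx, sub_zero] at h
  refine sub_eq_zero.1 (hM.eq_zero_of_rowComb_eq_zero hd (h.trans ?_).symm)
  simp [Matrix.mulVec_sub]

/-- Solutions of two perturbed problems, the second solution entering the bound. -/
theorem RowWProperty.seminorm_sub_le {n k : ℕ} {N : Seminorm ℝ (Fin n → ℝ)}
    (hN : ∀ x, N x = 0 → x = 0) {M : BlockMatrix n k} (hM : RowWProperty M) {η : ℝ}
    {A : BlockMatrix n k} (hA : A ∈ perturbationSet N M η) {B : BlockMatrix n k}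
    {q p : BlockVector n k} {x y : Fin n → ℝ} (hx : IsSolution A q x) (hy : IsSolution B p y) :
    N (x - y) ≤ (∑ i, tau N M η i * matNorm N (A i - B i)) * N y +
      ∑ i, tau N M η i * N (q i - p i) := by
  obtain ⟨d, hd, h⟩ := exists_blockMin_sub_blockMin (fun i => A i *ᵥ x + q i)
    fun i => B i *ᵥ y + p i
  rw [show blockMin (fun i => A i *ᵥ x + q i) = 0 from hx,
    show blockMin (fun i => B i *ᵥ y + p i) = 0 from hy, sub_zero] at h
  have h1 : (rowComb d fun i => A i *ᵥ (x - y)) =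
      rowComb d fun i => -((A i - B i) *ᵥ y + (q i - p i)) := by
    rw [← sub_eq_zero, h]
    funext l
    simp only [rowComb, Pi.sub_apply, ← Finset.sum_sub_distrib]
    refine Finset.sum_congr rfl fun i _ => ?_
    simp only [Matrix.mulVec_sub, Matrix.sub_mulVec, Pi.sub_apply, Pi.neg_apply, Pi.add_apply]
    ring
  refine (hM.le_sum_tau_mul hN hA hd h1).trans ?_
  rw [Finset.sum_mul, ← Finset.sum_add_distrib]
  refine Finset.sum_le_sum fun i _ => ?_
  have hη : 0 ≤ 1 - η := sub_nonneg.2 hA.2.le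
  rw [mul_assoc, ← mul_add, map_neg_eq_map]
  refine mul_le_mul_of_nonneg_left ((map_add_le_add N _ _).trans ?_)
    (mul_nonneg (by positivity) (alpha_nonneg N M i))
  exact add_le_add_left (le_matNorm_mul hN _ _) _

theorem tau_nonneg {n k : ℕ} (N : Seminorm ℝ (Fin n → ℝ)) (M : BlockMatrix n k) {η : ℝ}
    (hη : η < 1) (i : Fin (k + 1)) : 0 ≤ tau N M η i := by
  have : 0 ≤ 1 - η := sub_nonneg.2 hη.le
  exact mul_nonneg (by positivity) (alpha_nonneg N M i)

/-- Reference problem for the a priori bound on a solution of (B, p). -/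
theorem isSolution_zero {n k : ℕ} (M : BlockMatrix n k) : IsSolution M 0 0 := by
  funext l
  simp [blockMin]

end EVLCP

/-- `N` is an arbitrary norm on `ℝⁿ` (a seminorm that is definite), for instance a `p`-norm;
matrices carry the induced norm `EVLCP.matNorm N`. -/
theorem theorem3p2 {n k : ℕ} (N : Seminorm ℝ (Fin n → ℝ)) (hN : ∀ x, N x = 0 → x = 0)
    (M : EVLCP.BlockMatrix n k) (hM : EVLCP.RowWProperty M) (η : ℝ)
    (A B : EVLCP.BlockMatrix n k)
    (hA : A ∈ EVLCP.perturbationSet N M η) (hB : B ∈ EVLCP.perturbationSet N M η)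
    (q p : EVLCP.BlockVector n k) :
    (∃! x, EVLCP.IsSolution A q x) ∧ (∃! y, EVLCP.IsSolution B p y) ∧
      ∀ x y, EVLCP.IsSolution A q x → EVLCP.IsSolution B p y →
        N (x - y) ≤
          (∑ i, EVLCP.tau N M η i * EVLCP.matNorm N (A i - B i)) *
              (∑ i, EVLCP.tau N M η i * N (p i)) +
            ∑ i, EVLCP.tau N M η i * N (q i - p i) := by
  have hy : ∀ y, EVLCP.IsSolution B p y → N y ≤ ∑ i, EVLCP.tau N M η i * N (p i) := by
    intro y hy
    -- Comparison with the solution 0 of (B, 0): the term with matrix differences vanishes.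
    simpa using hM.seminorm_sub_le hN hB hy (EVLCP.isSolution_zero B)
  refine ⟨(hM.of_mem_perturbationSet hN hA).existsUnique_isSolution q,
    (hM.of_mem_perturbationSet hN hB).existsUnique_isSolution p, fun x y hxs hys => ?_⟩
  refine (hM.seminorm_sub_le hN hA hxs hys).trans ?_
  gcongr
  · exact Finset.sum_nonneg fun i _ =>
      mul_nonneg (EVLCP.tau_nonneg N M hA.2 i) (EVLCP.matNorm_nonneg N _)
  · exact hy y hys
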